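/- Let $K$ be a field, let $k\ge 1$ and $n\ge 3$ be integers, and let $S=K[x_1,\dots,x_n]$ with its $\mathbb Z^n$-grading. Let $C_n^k$ be the $k$-th power of the cycle $C_n$: the simple graph on $\{1,\dots,n\}$ in which distinct $i,j$ are adjacent if and only if $|j-i|\le k$ or $|j-i|\ge n-k$. Let $I=I(C_n^k)=(x_ix_j : \{i,j\}\in E(C_n^k))\subset S$ be its edge ideal. For a finitely generated $\mathbb Z^n$-graded $S$-module $M\neq 0$, a Stanley decomposition of $M$ is a decomposition of $M$ as a $K$-vector space into a finite direct sum $M=\bigoplus_{i=1}^s v_iK[W_i]$, where each $v_i\in M$ is homogeneous, $W_i\subseteq\{x_1,\dots,x_n\}$, and $v_iK[W_i]$ is free over $K[W_i]$ with basis $v_i$; and $\operatorname{sdepth}(M)$ is the maximum, over all Stanley decompositions of $M$, of $\min_i |W_i|$. Then $\operatorname{sdepth}(I)\ge \operatorname{sdepth}(S/I)$, that is, Herzog's conjecture holds for $I(C_n^k)$. More precisely: 1. If $n\le 2k+1$, then $\operatorname{sdepth}(I)\ge 2=\operatorname{sdepth}(S/I)+1$. 2. If $n\ge 2k+2$, then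 - $\operatorname{sdepth}(I)\ge \operatorname{sdepth}(S/I)$ if $n\equiv 1,\dots,k \pmod{2k+1}$; - $\operatorname{sdepth}(I)\ge \operatorname{sdepth}(S/I)+1$ if $n\equiv 0,k+1,\dots,2k \pmod{2k+1}$. -/

import Mathlib

noncomputable section

namespace StanleyDepth

open MvPolynomial

section Modules

variable {K : Type*} [Field K] {σ : Type*} [DecidableEq σ]
variable {M : Type*} [AddCommGroup M] [Module K M] [Module (MvPolynomial σ K) M]
  [IsScalarTower K (MvPolynomial σ K) M]

/-- The `K`-subspace `v K[W]` of a module `M` over `S = K[x_i : i ∈ σ]`: all the elements `f • v`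
with `f` in the subalgebra `K[W]` generated by the variables indexed by `W`. -/
def stanleySpace (K : Type*) [Field K] {σ : Type*} {M : Type*} [AddCommGroup M] [Module K M]
    [Module (MvPolynomial σ K) M] [IsScalarTower K (MvPolynomial σ K) M]
    (v : M) (W : Finset σ) : Submodule K M :=
  (Subalgebra.toSubmodule (supported K (W : Set σ))).map
    ((LinearMap.toSpanSingleton (MvPolynomial σ K) M v).restrictScalars K)

/-- A Stanley decomposition of a multigraded `S`-module `M`, with graded pieces `𝒜 a` for
`a ∈ ℤ^σ`: a finite family of homogeneous elements `v i` and of sets of variables `W i`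
such that each `v i K[W i]` is free over `K[W i]` with basis `v i`, and such that `M` is, as a
`K`-vector space, the direct sum of the `v i K[W i]`. -/
structure StanleyDecomposition (𝒜 : (σ → ℤ) → Submodule K M) where
  /-- the number of Stanley spaces -/
  s : ℕ
  /-- the generators -/
  v : Fin s → M
  /-- the sets of variables -/
  W : Fin s → Finset σ
  homogeneous : ∀ i, ∃ a, v i ∈ 𝒜 a
  free : ∀ i, ∀ f ∈ supported K (W i : Set σ), f • v i = 0 → f = 0
  isInternal : DirectSum.IsInternal fun i => stanleySpace K (v i) (W i)

/-- The Stanley depth of a decomposition: the least of the numbers `|W i|`. -/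
def StanleyDecomposition.sdepth {𝒜 : (σ → ℤ) → Submodule K M} (D : StanleyDecomposition 𝒜) : ℕ∞ :=
  ⨅ i, ((D.W i).card : ℕ∞)

/-- The Stanley depth of a multigraded module: the largest Stanley depth of a Stanley
decomposition. For `M ≠ 0` and `σ` finite every decomposition is nonempty and so has Stanley depth
at most `|σ|`, hence the supremum is a maximum (the zero module gets the value `⊤`). -/
def sdepth (𝒜 : (σ → ℤ) → Submodule K M) : ℕ∞ :=
  ⨆ D : StanleyDecomposition 𝒜, D.sdepth

end Modules

section Ideals

variable {K : Type*} [Field K] {σ : Type*} [DecidableEq σ]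

/-- The graded piece of degree `a ∈ ℤ^σ` of the polynomial ring, where `x_i` has as its degree the
`i`-th unit vector. It is spanned by the monomial `x^a` if `a ≥ 0`, and is `0` otherwise. -/
def multigrading (K : Type*) [Field K] (σ : Type*) [DecidableEq σ] (a : σ → ℤ) :
    Submodule K (MvPolynomial σ K) :=
  weightedHomogeneousSubmodule K (fun i : σ => (Pi.single i 1 : σ → ℤ)) a

/-- The multigrading that an ideal `I` of `S` inherits from `S`: `I_a = I ∩ S_a`. -/
def idealGrading (I : Ideal (MvPolynomial σ K)) (a : σ → ℤ) : Submodule K I :=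
  (multigrading K σ a).comap (I.subtype.restrictScalars K)

/-- The multigrading that `S ⧸ I` inherits from `S`: `(S ⧸ I)_a` is the image of `S_a`. -/
def quotientGrading (I : Ideal (MvPolynomial σ K)) (a : σ → ℤ) :
    Submodule K (MvPolynomial σ K ⧸ I) :=
  (multigrading K σ a).map (I.mkQ.restrictScalars K)

/-- The edge ideal of a simple graph. -/
def edgeIdeal (K : Type*) [Field K] {σ : Type*} (G : SimpleGraph σ) : Ideal (MvPolynomial σ K) :=
  Ideal.span {f | ∃ i j, G.Adj i j ∧ f = X i * X j}

end Ideals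

/-- The `k`-th power of the cycle on `n` vertices: distinct vertices `i`, `j` are adjacent if and
only if `|j - i| ≤ k` or `|j - i| ≥ n - k`, that is, if and only if they are at distance at
most `k` on the cycle. -/
def cyclePower (n k : ℕ) : SimpleGraph (Fin n) where
  Adj i j := i ≠ j ∧
    (|((j : ℕ) : ℤ) - ((i : ℕ) : ℤ)| ≤ (k : ℤ) ∨ (n : ℤ) - (k : ℤ) ≤ |((j : ℕ) : ℤ) - ((i : ℕ) : ℤ)|)
  symm := ⟨fun i j h => ⟨h.1.symm, by rw [abs_sub_comm]; exact h.2⟩⟩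
  loopless := ⟨fun _ h => h.1 rfl⟩

/-- The edge ideal `I(C_n^k)` in `K[x_1, …, x_n]`. -/
abbrev cycleIdeal (K : Type*) [Field K] (n k : ℕ) : Ideal (MvPolynomial (Fin n) K) :=
  edgeIdeal K (cyclePower n k)

end StanleyDepth

end

/-! A monomial lies in the edge ideal exactly when its support is dependent, i.e. contains an edge.
Hence a partition of the dependent sets into intervals [A, B] with |B| ≥ d gives the Stanley
decomposition of I into the spaces x^A K[B], and sdepth(I) ≥ d (`le_sdepth_idealGrading`).
Conversely, sdepth(S/I) is at most the size of any maximal independent set A: the Stanley space that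
contributes x^A can only use variables of A (`sdepth_quotientGrading_le`).

Write n = q(2k+1) + r with q ≥ 1 and 1 ≤ r ≤ 2k+1. Points spaced by at most 2k+1 around the cycle
give a maximal independent set of size at most q+1, so sdepth(S/I) ≤ q+1. On the other side,
sdepth(I) ≥ c+2 whenever c(2k+1) + k < n (`intervalPartition_cyclePower`). The choice c = q-1 is
always allowed and gives q+1; the choice c = q is allowed once r ≥ k+1 and gives q+2.

The bound for I comes from eliminating a vertex v (`dependentSets_of_erase`). A dependent set avoids
v, or contains v and no neighbour of v, or contains v and a neighbour. The first two kinds are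
handled by smaller graphs, the third by explicit large intervals. Eliminating k consecutive vertices
cuts the cycle into a power of a path; on a path, eliminating the k vertices next to an end isolates
that end, which gains one in depth at the cost of 2k+1 vertices. -/

namespace StanleyDepth

/-! ### Interval partitions of families of finite sets -/

open Finset

/-- `IntervalPartition d F` says that the family `F` of finite sets is a finite disjoint union of
intervals `[A, B]` with `d ≤ |B|`. -/
inductive IntervalPartition {V : Type*} [DecidableEq V] (d : ℕ) : Set (Finset V) → Prop
  | empty : IntervalPartition d ∅
  | icc (A B : Finset V) : A ⊆ B → d ≤ B.card → IntervalPartition d (Set.Icc A B)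
  | union (F G : Set (Finset V)) : Disjoint F G → IntervalPartition d F → IntervalPartition d G →
      IntervalPartition d (F ∪ G)

namespace IntervalPartition

variable {V : Type*} [DecidableEq V] {d : ℕ} {F : Set (Finset V)}

/-- Flattens the inductive construction into one finite family, the form in which a Stanley
decomposition is built. -/
theorem exists_indexed (h : IntervalPartition d F) :
    ∃ (ι : Type) (_ : Fintype ι) (A B : ι → Finset V), (∀ i, A i ⊆ B i ∧ d ≤ (B i).card) ∧
      (∀ i, Set.Icc (A i) (B i) ⊆ F) ∧ ∀ C ∈ F, ∃! i, C ∈ Set.Icc (A i) (B i) := by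
  induction h with
  | empty => exact ⟨Empty, inferInstance, Empty.elim, Empty.elim, by simp, by simp, by simp⟩
  | icc A B hAB hd =>
    exact ⟨Unit, inferInstance, fun _ => A, fun _ => B, by simp [hAB, hd], by simp,
      fun C hC => ⟨(), hC, fun _ _ => rfl⟩⟩
  | union F G hFG _ _ ihF ihG =>
    obtain ⟨ι, _, A, B, h1, h2, h3⟩ := ihF
    obtain ⟨κ, _, A', B', h1', h2', h3'⟩ := ihG
    refine ⟨ι ⊕ κ, inferInstance, Sum.elim A A', Sum.elim B B', ?_, ?_, ?_⟩
    · rintro (i | i)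
      · exact h1 i
      · exact h1' i
    · rintro (i | i)
      · exact (h2 i).trans Set.subset_union_left
      · exact (h2' i).trans Set.subset_union_right
    · rintro C (hC | hC)
      · obtain ⟨i, hi, hu⟩ := h3 C hC
        refine ⟨.inl i, hi, ?_⟩
        rintro (j | j) hj
        · exact congrArg _ (hu j hj)
        · exact (Set.disjoint_left.1 hFG hC (h2' j hj)).elim
      · obtain ⟨i, hi, hu⟩ := h3' C hC
        refine ⟨.inr i, hi, ?_⟩
        rintro (j | j) hj
        · exact (Set.disjoint_left.1 hFG (h2 j hj) hC).elim
        · exact congrArg _ (hu j hj)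

/-- If A is not contained in B the interval is empty. This case occurs in `meeting`, where the upper
end shrinks and may lose elements of A. -/
theorem icc_of_card (A B : Finset V) (hd : d ≤ B.card) : IntervalPartition d (Set.Icc A B) := by
  by_cases h : A ⊆ B
  · exact .icc A B h hd
  · rw [Set.Icc_eq_empty h]
    exact .empty

theorem of_forall_card (hF : F.Finite) (h : ∀ B ∈ F, d ≤ B.card) : IntervalPartition d F := by
  induction F, hF using Set.Finite.induction_on with
  | empty => exact .empty
  | @insert B F hB _ ih =>
    rw [Set.insert_eq, ← Set.Icc_self]
    refine .union _ _ (by simpa using hB) (icc_of_card _ _ (h B (by simp)))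
      (ih fun C hC => h C (by simp [hC]))

/-- Both ends of every interval receive v, so upper ends grow by one. -/
theorem image_insert (h : IntervalPartition d F) {v : V} (hv : ∀ B ∈ F, v ∉ B) :
    IntervalPartition (d + 1) (insert v '' F) := by
  induction h with
  | empty => simpa using .empty
  | icc A B hAB hd =>
    have hvB : v ∉ B := hv B ⟨hAB, le_rfl⟩
    have : insert v '' Set.Icc A B = Set.Icc (insert v A) (insert v B) := by
      ext C
      constructor
      · rintro ⟨D, hD, rfl⟩
        exact ⟨insert_subset_insert v hD.1, insert_subset_insert v hD.2⟩
      · rintro ⟨h1, h2⟩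
        refine ⟨C.erase v, ⟨?_, ?_⟩, insert_erase (h1 (mem_insert_self v A))⟩
        · exact subset_erase.2 ⟨(subset_insert v A).trans h1, fun h => hvB (hAB h)⟩
        · exact subset_insert_iff.1 h2
    rw [this]
    exact .icc _ _ (insert_subset_insert v hAB) (by rw [card_insert_of_notMem hvB]; omega)
  | union F G hFG _ _ ihF ihG =>
    rw [Set.image_union]
    refine .union _ _ ?_ (ihF fun B hB => hv B (.inl hB)) (ihG fun B hB => hv B (.inr hB))
    rw [Set.disjoint_left]
    rintro _ ⟨B, hB, rfl⟩ ⟨C, hC, hBC⟩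
    have : B = C := by
      rw [← erase_insert (hv B (.inl hB)), ← erase_insert (hv C (.inr hC)), hBC]
    exact Set.disjoint_left.1 hFG hB (this ▸ hC)

/-- Membership of v is left free: [A, B] becomes [A, B ∪ {v}], and upper ends again grow by one. -/
theorem preimage_erase (h : IntervalPartition d F) {v : V} (hv : ∀ B ∈ F, v ∉ B) :
    IntervalPartition (d + 1) ((fun B => B.erase v) ⁻¹' F) := by
  induction h with
  | empty => simpa using .empty
  | icc A B hAB hd =>
    have hvB : v ∉ B := hv B ⟨hAB, le_rfl⟩
    have : (fun B => B.erase v) ⁻¹' Set.Icc A B = Set.Icc A (insert v B) := by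
      ext C
      have hvA : v ∉ A := fun h => hvB (hAB h)
      rw [Set.mem_preimage, Set.mem_Icc, Set.mem_Icc, subset_erase, subset_insert_iff]
      tauto
    rw [this]
    exact .icc _ _ (hAB.trans (subset_insert v B)) (by rw [card_insert_of_notMem hvB]; omega)
  | union F G hFG _ _ ihF ihG =>
    rw [Set.preimage_union]
    exact .union _ _ (hFG.preimage _) (ihF fun B hB => hv B (.inl hB))
      (ihG fun B hB => hv B (.inr hB))

/-- The sets between `A` and `U` that meet `N`. -/
theorem meeting (N : Finset V) : ∀ A U : Finset V, N ⊆ U → d + N.card ≤ U.card + 1 →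
    IntervalPartition d {B | A ⊆ B ∧ B ⊆ U ∧ ∃ y ∈ N, y ∈ B} := by
  induction N using Finset.induction_on with
  | empty => intro A U _ _; simpa using .empty
  | @insert y N hy ih =>
    intro A U hNU hd
    rw [card_insert_of_notMem hy] at hd
    have hyU : y ∈ U := hNU (mem_insert_self y N)
    -- The sets are sorted by the first element of N they contain. Each element passed over is
    -- removed from the upper end, so the smallest upper end has |U| - |N| + 1 elements.
    have : {B | A ⊆ B ∧ B ⊆ U ∧ ∃ z ∈ insert y N, z ∈ B} =
        Set.Icc (insert y A) U ∪ {B | A ⊆ B ∧ B ⊆ U.erase y ∧ ∃ z ∈ N, z ∈ B} := by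
      ext B
      simp only [Set.mem_ofPred_eq, Set.mem_union, Set.mem_Icc,
        insert_subset_iff, subset_erase, mem_insert, exists_eq_or_imp]
      tauto
    rw [this]
    refine .union _ _ ?_ (icc_of_card _ _ (by omega)) (ih A (U.erase y) ?_ ?_)
    · rw [Set.disjoint_left]
      rintro B ⟨h1, _⟩ ⟨_, h2, _⟩
      exact notMem_erase y U (h2 (h1 (mem_insert_self y A)))
    · exact subset_erase.2 ⟨(subset_insert y N).trans hNU, hy⟩
    · rw [card_erase_of_mem hyU]; omega

end IntervalPartition

/-! ### Dependent sets of a graph and elimination of vertices -/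

section Graph

variable {V : Type*} [DecidableEq V] {d e : ℕ} (G : SimpleGraph V)

/-- The subsets of `U` that are not independent in `G`. -/
def dependentSets (U : Finset V) : Set (Finset V) :=
  {B | B ⊆ U ∧ ∃ i ∈ B, ∃ j ∈ B, G.Adj i j}

variable {G}

theorem intervalPartition_dependentSets_two (U : Finset V) :
    IntervalPartition 2 (dependentSets G U) := by
  refine .of_forall_card (U.powerset.finite_toSet.subset fun B hB => by simpa using hB.1) ?_
  rintro B ⟨_, i, hi, j, hj, hij⟩
  exact one_lt_card.2 ⟨i, hi, j, hj, hij.ne⟩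

/-- An isolated vertex lies on no edge, so a set is dependent exactly when it is so after v is
erased. -/
theorem IntervalPartition.dependentSets_insert_isolated {U : Finset V} {v : V} (hv : v ∉ U)
    (hU : ∀ i ∈ U, ¬ G.Adj v i) (h : IntervalPartition d (dependentSets G U)) :
    IntervalPartition (d + 1) (dependentSets G (insert v U)) := by
  convert h.preimage_erase (v := v) fun B hB hvB => hv (hB.1 hvB) using 1
  ext B
  simp only [dependentSets, Set.mem_ofPred_eq, Set.mem_preimage, ← subset_insert_iff]
  refine and_congr_right fun hB => ⟨?_, ?_⟩
  · rintro ⟨i, hi, j, hj, hij⟩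
    have key : ∀ a ∈ B, ∀ b ∈ B, G.Adj a b → a ≠ v := by
      rintro a _ b hb hab rfl
      rcases mem_insert.1 (hB hb) with rfl | h
      · exact G.loopless.irrefl _ hab
      · exact hU _ h hab
    exact ⟨i, mem_erase.2 ⟨key i hi j hj hij, hi⟩, j,
      mem_erase.2 ⟨key j hj i hi hij.symm, hj⟩, hij⟩
  · rintro ⟨i, hi, j, hj, hij⟩
    exact ⟨i, mem_of_mem_erase hi, j, mem_of_mem_erase hj, hij⟩

variable [DecidableRel G.Adj]

/-- With N the neighbours and T the non-neighbours of v in U, a dependent set containing v either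
misses N, and is then v added to a dependent subset of T, or meets N and is dependent automatically.
The latter sets are covered by `meeting`, with upper ends of size at least |U| - |N| + 1 = |T| + 2;
this is the origin of `he`. -/
theorem IntervalPartition.dependentSets_of_erase {U : Finset V} {v : V} (hv : v ∈ U)
    (h : IntervalPartition (e + 1) (dependentSets G (U.erase v)))
    (h' : IntervalPartition e (dependentSets G {i ∈ U | i ≠ v ∧ ¬ G.Adj v i}))
    (he : e ≤ #{i ∈ U | i ≠ v ∧ ¬ G.Adj v i} + 1) :
    IntervalPartition (e + 1) (dependentSets G U) := by
  set N : Finset V := {i ∈ U | G.Adj v i} with hN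
  set T : Finset V := {i ∈ U | i ≠ v ∧ ¬ G.Adj v i} with hT
  have hcard : U.card = N.card + T.card + 1 := by
    have h1 : U = insert v (N ∪ T) := by
      ext i
      simp only [hN, hT, mem_insert, mem_union, mem_filter]
      by_cases hi : i = v
      · simp [hi, hv]
      · simp only [hi]; tauto
    have h2 : v ∉ N ∪ T := by simp [hN, hT]
    have h3 : Disjoint N T := by
      rw [Finset.disjoint_left]
      intro i hi hi'
      simp only [hN, hT, mem_filter] at hi hi'
      tauto
    conv_lhs => rw [h1]
    rw [card_insert_of_notMem h2, card_union_of_disjoint h3]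
  have hvT : ∀ B ∈ dependentSets G T, v ∉ B := fun B hB hvB => by
    simpa [hT] using hB.1 hvB
  have key : dependentSets G U = dependentSets G (U.erase v) ∪
      (insert v '' dependentSets G T ∪ {B | {v} ⊆ B ∧ B ⊆ U ∧ ∃ y ∈ N, y ∈ B}) := by
    ext B
    constructor
    · rintro ⟨hB, i, hi, j, hj, hij⟩
      by_cases hvB : v ∈ B
      · by_cases hm : ∃ y ∈ N, y ∈ B
        · exact .inr (.inr ⟨by simpa using hvB, hB, hm⟩)
        · push Not at hm
          have hBN : ∀ a ∈ B, ¬ G.Adj v a := fun a ha hva =>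
            hm a (by simp [hN, hB ha, hva]) ha
          refine .inr (.inl ⟨B.erase v, ⟨?_, i, ?_, j, ?_, hij⟩, insert_erase hvB⟩)
          · intro a ha
            rw [mem_erase] at ha
            simp only [hT, mem_filter]
            exact ⟨hB ha.2, ha.1, hBN a ha.2⟩
          · exact mem_erase.2 ⟨fun h => hBN j hj (h ▸ hij), hi⟩
          · exact mem_erase.2 ⟨fun h => hBN i hi (h ▸ hij.symm), hj⟩
      · exact .inl ⟨subset_erase.2 ⟨hB, hvB⟩, i, hi, j, hj, hij⟩
    · rintro (⟨hB, h⟩ | ⟨B, ⟨hB, i, hi, j, hj, hij⟩, rfl⟩ | ⟨hv', hB, y, hy, hyB⟩)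
      · exact ⟨hB.trans (erase_subset v U), h⟩
      · exact ⟨insert_subset hv (hB.trans (filter_subset _ _)), i, mem_insert_of_mem hi, j,
          mem_insert_of_mem hj, hij⟩
      · exact ⟨hB, v, by simpa using hv', y, hyB, (mem_filter.1 hy).2⟩
  rw [key]
  refine .union _ _ ?_ h (.union _ _ ?_ (h'.image_insert hvT) (.meeting _ _ _ ?_ ?_))
  · rw [Set.disjoint_left]
    rintro B ⟨hB, _⟩ (⟨C, _, rfl⟩ | ⟨hvB, _⟩)
    · exact notMem_erase v U (hB (mem_insert_self v C))
    · exact notMem_erase v U (hB (by simpa using hvB))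
  · rw [Set.disjoint_left]
    rintro _ ⟨B, hB, rfl⟩ ⟨_, _, y, hy, hyB⟩
    have hvy := (mem_filter.1 hy).2
    rcases mem_insert.1 hyB with rfl | h
    · exact G.loopless.irrefl _ hvy
    · exact (mem_filter.1 (hB.1 h)).2.2 hvy
  · exact filter_subset _ _
  · omega

/-- Elimination of the vertices of a clique `R`. -/
theorem IntervalPartition.dependentSets_of_sdiff {U : Finset V} (R : Finset V) (hR : R ⊆ U)
    (hclique : ∀ i ∈ R, ∀ j ∈ R, i ≠ j → G.Adj i j)
    (h : IntervalPartition (e + 1) (dependentSets G (U \ R)))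
    (h' : ∀ v ∈ R, IntervalPartition e (dependentSets G {i ∈ U | i ≠ v ∧ ¬ G.Adj v i}))
    (he : ∀ v ∈ R, e ≤ #{i ∈ U | i ≠ v ∧ ¬ G.Adj v i} + 1) :
    IntervalPartition (e + 1) (dependentSets G U) := by
  induction R using Finset.induction_on generalizing U with
  | empty => simpa using h
  | @insert v R hv ih =>
    -- In a clique, v is a neighbour of w, so erasing v does not change the non-neighbours of w. The
    -- hypotheses can therefore all be stated for the original U.
    have hsdiff : ∀ w ∈ R, ({i ∈ U.erase v | i ≠ w ∧ ¬ G.Adj w i} : Finset V) =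
        {i ∈ U | i ≠ w ∧ ¬ G.Adj w i} := by
      intro w hw
      have hwv : G.Adj w v := hclique w (mem_insert_of_mem hw) v (mem_insert_self v R)
        (fun h => hv (h ▸ hw))
      ext i
      simp only [mem_filter, mem_erase]
      constructor
      · tauto
      · rintro ⟨h1, h2, h3⟩
        exact ⟨⟨fun h => h3 (h ▸ hwv), h1⟩, h2, h3⟩
    refine .dependentSets_of_erase (hR (mem_insert_self v R)) (ih ?_ ?_ ?_ ?_ ?_)
      (h' v (mem_insert_self v R)) (he v (mem_insert_self v R))
    · exact subset_erase.2 ⟨(subset_insert v R).trans hR, hv⟩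
    · exact fun i hi j hj => hclique i (mem_insert_of_mem hi) j (mem_insert_of_mem hj)
    · rwa [erase_sdiff_comm, ← sdiff_insert]
    · intro w hw
      rw [hsdiff w hw]
      exact h' w (mem_insert_of_mem hw)
    · intro w hw
      rw [hsdiff w hw]
      exact he w (mem_insert_of_mem hw)

end Graph

end StanleyDepth

/-! ### Stanley decompositions from monomial bases -/

noncomputable section
namespace StanleyDepth

open MvPolynomial

section Modules

variable {K : Type*} [Field K] {σ : Type*}
variable {M : Type*} [AddCommGroup M] [Module K M] [Module (MvPolynomial σ K) M]
  [IsScalarTower K (MvPolynomial σ K) M]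

theorem mem_supported_iff_forall_support {f : MvPolynomial σ K} {W : Finset σ} :
    f ∈ supported K (W : Set σ) ↔ ∀ m ∈ f.support, m.support ⊆ W := by
  rw [mem_supported, Finset.coe_subset]
  constructor
  · intro h m hm i hi
    exact h ((mem_vars_iff_mem_support i).2 ⟨m, hm, hi⟩)
  · intro h i hi
    obtain ⟨m, hm, him⟩ := (mem_vars_iff_mem_support i).1 hi
    exact h m hm him

theorem monomial_mem_supported {m : σ →₀ ℕ} {W : Finset σ} (hm : m.support ⊆ W) (c : K) :
    monomial m c ∈ supported K (W : Set σ) := by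
  rw [mem_supported_iff_forall_support]
  intro m' hm'
  obtain rfl := Finset.mem_singleton.1 (support_monomial_subset hm')
  exact hm

theorem mem_stanleySpace {v x : M} {W : Finset σ} :
    x ∈ stanleySpace K v W ↔ ∃ f ∈ supported K (W : Set σ), f • v = x := by
  simp [stanleySpace, Submodule.mem_map]

theorem smul_eq_sum_monomial_smul (f : MvPolynomial σ K) (v : M) :
    f • v = ∑ m ∈ f.support, f.coeff m • (monomial m (1 : K) • v) := by
  conv_lhs => rw [f.as_sum, Finset.sum_smul]
  refine Finset.sum_congr rfl fun m _ => ?_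
  rw [← smul_assoc, smul_monomial, smul_eq_mul, mul_one]

variable {T : Set (σ →₀ ℕ)} (b : Module.Basis T K M)

/-- Distinct monomials in the variables of W carry `b t` to distinct basis vectors, so f can be
recovered from `f • b t`; this yields freeness of the Stanley spaces. Nothing is assumed about
products leaving T, so the same argument serves S/I, where they vanish. -/
theorem repr_smul_basis
    (hsmul : ∀ (t : T) (m : σ →₀ ℕ) (h : t.1 + m ∈ T),
      monomial m (1 : K) • b t = b ⟨t.1 + m, h⟩)
    {t : T} {W : Finset σ} (hadd : ∀ m : σ →₀ ℕ, m.support ⊆ W → t.1 + m ∈ T)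
    {f : MvPolynomial σ K} (hf : f ∈ supported K (W : Set σ)) {m : σ →₀ ℕ} (hm : m.support ⊆ W) :
    b.repr (f • b t) ⟨t.1 + m, hadd m hm⟩ = f.coeff m := by
  classical
  rw [smul_eq_sum_monomial_smul, map_sum, Finsupp.finsetSum_apply]
  have hterm : ∀ m' ∈ f.support,
      b.repr (f.coeff m' • (monomial m' (1 : K) • b t)) ⟨t.1 + m, hadd m hm⟩ =
        if m' = m then f.coeff m' else 0 := by
    intro m' hm'
    rw [hsmul t m' (hadd m' (mem_supported_iff_forall_support.1 hf m' hm')), map_smul,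
      Module.Basis.repr_self, Finsupp.smul_apply, Finsupp.single_apply]
    simp [Subtype.ext_iff]
  rw [Finset.sum_congr rfl hterm, Finset.sum_ite_eq']
  split_ifs with h
  · rfl
  · exact (notMem_support_iff.1 h).symm

theorem stanleySpace_basis
    (hsmul : ∀ (t : T) (m : σ →₀ ℕ) (h : t.1 + m ∈ T),
      monomial m (1 : K) • b t = b ⟨t.1 + m, h⟩)
    {t : T} {W : Finset σ} (hadd : ∀ m : σ →₀ ℕ, m.support ⊆ W → t.1 + m ∈ T) :
    stanleySpace K (b t) W =
      Submodule.span K (b '' {u | ∃ m : σ →₀ ℕ, m.support ⊆ W ∧ t.1 + m = u.1}) := by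
  apply le_antisymm
  · intro x hx
    obtain ⟨f, hf, rfl⟩ := mem_stanleySpace.1 hx
    rw [smul_eq_sum_monomial_smul]
    refine Submodule.sum_mem _ fun m hm => Submodule.smul_mem _ _ (Submodule.subset_span ?_)
    have hmW := mem_supported_iff_forall_support.1 hf m hm
    exact ⟨⟨_, hadd m hmW⟩, ⟨m, hmW, rfl⟩, (hsmul t m _).symm⟩
  · rw [Submodule.span_le]
    rintro _ ⟨⟨u, hu⟩, ⟨m, hm, rfl⟩, rfl⟩
    exact mem_stanleySpace.2 ⟨monomial m 1, monomial_mem_supported hm 1, hsmul t m hu⟩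

variable [DecidableEq σ]

/-- If `M` has a `K`-basis of monomials with exponents in `T`, a partition of `T` into translates
of coordinate orthants gives a Stanley decomposition. -/
theorem le_sdepth_of_basis {𝒜 : (σ → ℤ) → Submodule K M}
    (hmem : ∀ t : T, ∃ a, b t ∈ 𝒜 a)
    (hsmul : ∀ (t : T) (m : σ →₀ ℕ) (h : t.1 + m ∈ T),
      monomial m (1 : K) • b t = b ⟨t.1 + m, h⟩)
    {ι : Type*} [Fintype ι] (t : ι → T) (W : ι → Finset σ)
    (hadd : ∀ i, ∀ m : σ →₀ ℕ, m.support ⊆ W i → (t i).1 + m ∈ T)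
    (hpart : ∀ u ∈ T, ∃! i, ∃ m : σ →₀ ℕ, m.support ⊆ W i ∧ (t i).1 + m = u)
    {d : ℕ} (hd : ∀ i, d ≤ (W i).card) : (d : ℕ∞) ≤ sdepth 𝒜 := by
  let e := (Fintype.equivFin ι).symm
  let D : StanleyDecomposition 𝒜 :=
    { s := Fintype.card ι
      v := fun i => b (t (e i))
      W := fun i => W (e i)
      homogeneous := fun i => hmem _
      free := by
        intro i f hf h0
        ext m
        rw [coeff_zero]
        by_cases hm : m ∈ f.support
        · have := repr_smul_basis b hsmul (hadd (e i)) hf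
            (mem_supported_iff_forall_support.1 hf m hm)
          rw [← this, h0]
          simp
        · exact notMem_support_iff.1 hm
      isInternal := by
        apply DirectSum.isInternal_submodule_of_iSupIndep_of_iSup_eq_top
        · intro i
          simp only [stanleySpace_basis b hsmul (hadd _)]
          rw [← Submodule.span_iUnion₂, ← Set.image_iUnion₂]
          refine b.linearIndependent.disjoint_span_image (Set.disjoint_left.2 ?_)
          rintro u hu hu'
          simp only [Set.mem_iUnion] at hu'
          obtain ⟨j, hj, hu'⟩ := hu'
          exact hj (e.injective ((hpart u.1 u.2).unique hu' hu))
        · simp only [stanleySpace_basis b hsmul (hadd _)]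
          rw [← Submodule.span_iUnion, ← Set.image_iUnion, ← b.span_eq, ← Set.image_univ]
          congr 2
          refine Set.eq_univ_of_forall fun u => Set.mem_iUnion.2 ?_
          obtain ⟨i, hi, _⟩ := hpart u.1 u.2
          exact ⟨e.symm i, by simpa using hi⟩ }
  refine le_trans ?_ (le_iSup (fun D : StanleyDecomposition 𝒜 => D.sdepth) D)
  exact le_iInf fun i => by exact_mod_cast hd (e i)

end Modules

/-! ### Edge ideals and their quotients -/

section Ideals

variable {K : Type*} [Field K] {σ : Type*}

/-- The exponents of the monomials in the edge ideal of `G`. -/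
def edgeExponents (G : SimpleGraph σ) : Set (σ →₀ ℕ) :=
  {m | ∃ i ∈ m.support, ∃ j ∈ m.support, G.Adj i j}

theorem mem_edgeIdeal_iff {G : SimpleGraph σ} {f : MvPolynomial σ K} :
    f ∈ edgeIdeal K G ↔ ∀ m ∈ f.support, m ∈ edgeExponents G := by
  have h : edgeIdeal K G = Ideal.span ((fun s => monomial s (1 : K)) ''
      {s | ∃ i j, G.Adj i j ∧ s = Finsupp.single i 1 + Finsupp.single j 1}) := by
    unfold edgeIdeal
    congr 1
    ext f
    constructor
    · rintro ⟨i, j, hij, rfl⟩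
      exact ⟨_, ⟨i, j, hij, rfl⟩, by simp [X, monomial_mul]⟩
    · rintro ⟨_, ⟨i, j, hij, rfl⟩, rfl⟩
      exact ⟨i, j, hij, by simp [X, monomial_mul]⟩
  rw [h, mem_ideal_span_monomial_image]
  refine forall₂_congr fun m _ => ?_
  constructor
  · rintro ⟨_, ⟨i, j, hij, rfl⟩, hle⟩
    refine ⟨i, ?_, j, ?_, hij⟩
    · have := hle i
      simp only [Finsupp.add_apply, Finsupp.single_eq_same] at this
      rw [Finsupp.mem_support_iff]; omega
    · have := hle j
      simp only [Finsupp.add_apply, Finsupp.single_eq_same] at this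
      rw [Finsupp.mem_support_iff]; omega
  · classical
    rintro ⟨i, hi, j, hj, hij⟩
    refine ⟨_, ⟨i, j, hij, rfl⟩, fun l => ?_⟩
    rw [Finsupp.mem_support_iff] at hi hj
    have := hij.ne
    simp only [Finsupp.add_apply, Finsupp.single_apply]
    split_ifs with h1 h2 h2 <;> subst_vars <;> first | omega | exact (this rfl).elim

theorem monomial_mem_edgeIdeal_iff {G : SimpleGraph σ} {m : σ →₀ ℕ} {c : K} (hc : c ≠ 0) :
    monomial m c ∈ edgeIdeal K G ↔ m ∈ edgeExponents G := by
  classical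
  rw [mem_edgeIdeal_iff, support_monomial, if_neg hc]
  simp

/-- The monomials in the edge ideal form a basis of it. -/
theorem exists_basis_edgeIdeal (G : SimpleGraph σ) :
    ∃ b : Module.Basis (edgeExponents G) K (edgeIdeal K G),
      ∀ t, (b t : MvPolynomial σ K) = monomial t.1 1 := by
  let v : edgeExponents G → edgeIdeal K G := fun t =>
    ⟨monomial t.1 1, (monomial_mem_edgeIdeal_iff one_ne_zero).2 t.2⟩
  have hli : LinearIndependent K v := by
    refine LinearIndependent.of_comp ((edgeIdeal K G).subtype.restrictScalars K) ?_
    have hv : (edgeIdeal K G).subtype.restrictScalars K ∘ v =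
        basisMonomials σ K ∘ (Subtype.val : edgeExponents G → σ →₀ ℕ) := by
      ext1 t
      simp [v]
    rw [hv]
    exact (basisMonomials σ K).linearIndependent.comp _ Subtype.val_injective
  refine ⟨Module.Basis.mk hli ?_, fun t => by rw [Module.Basis.mk_apply]⟩
  rintro ⟨f, hf⟩ -
  have hf' := mem_edgeIdeal_iff.1 hf
  have : (⟨f, hf⟩ : edgeIdeal K G) = ∑ m ∈ f.support.attach, f.coeff m.1 • v ⟨m.1, hf' _ m.2⟩ := by
    apply Subtype.ext
    rw [AddSubmonoidClass.coe_finsetSum]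
    refine (f.as_sum.trans (Finset.sum_attach _ _).symm).trans ?_
    refine Finset.sum_congr rfl fun m _ => ?_
    change _ = f.coeff m.1 • monomial m.1 (1 : K)
    rw [smul_monomial, smul_eq_mul, mul_one]
  rw [this]
  exact Submodule.sum_mem _ fun m _ => Submodule.smul_mem _ _ (Submodule.subset_span ⟨_, rfl⟩)

/-- The monomials outside the edge ideal form a basis of the quotient. -/
theorem exists_basis_quotient_edgeIdeal (G : SimpleGraph σ) :
    ∃ b : Module.Basis ((edgeExponents G)ᶜ : Set (σ →₀ ℕ)) K (MvPolynomial σ K ⧸ edgeIdeal K G),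
      ∀ t, b t = (edgeIdeal K G).mkQ (monomial t.1 1) := by
  let π := (edgeIdeal K G).mkQ.restrictScalars K
  let v : ((edgeExponents G)ᶜ : Set (σ →₀ ℕ)) → MvPolynomial σ K ⧸ edgeIdeal K G :=
    fun t => π (monomial t.1 1)
  have hli : LinearIndependent K v := by
    classical
    rw [linearIndependent_iff']
    intro s g hg i hi
    have h1 : π (∑ t ∈ s, g t • monomial t.1 1) = 0 := by
      rw [map_sum, ← hg]
      exact Finset.sum_congr rfl fun t _ => map_smul _ _ _
    have h2 : (∑ t ∈ s, g t • monomial t.1 (1 : K)) ∈ edgeIdeal K G :=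
      (Submodule.Quotient.mk_eq_zero _).1 h1
    by_contra h
    refine i.2 (mem_edgeIdeal_iff.1 h2 i.1 ?_)
    rw [mem_support_iff, coeff_sum]
    rw [Finset.sum_eq_single i]
    · simpa [coeff_monomial] using h
    · intro j _ hj
      simp [coeff_monomial, Subtype.ext_iff.not.1 hj]
    · exact fun h => (h hi).elim
  refine ⟨Module.Basis.mk hli ?_, fun t => by rw [Module.Basis.mk_apply]; rfl⟩
  intro x _
  obtain ⟨f, rfl⟩ := (edgeIdeal K G).mkQ_surjective x
  change π f ∈ _
  rw [f.as_sum, map_sum]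
  refine Submodule.sum_mem _ fun m _ => ?_
  by_cases hm : m ∈ edgeExponents G
  · have : π (monomial m (f.coeff m)) = 0 := by
      refine (Submodule.Quotient.mk_eq_zero _).2 (mem_edgeIdeal_iff.2 fun m' hm' => ?_)
      obtain rfl := Finset.mem_singleton.1 (support_monomial_subset hm')
      exact hm
    rw [this]
    exact Submodule.zero_mem _
  · have : monomial m (f.coeff m) = f.coeff m • monomial m (1 : K) := by
      rw [smul_monomial, smul_eq_mul, mul_one]
    rw [this, map_smul]
    exact Submodule.smul_mem _ _ (Submodule.subset_span ⟨⟨m, hm⟩, rfl⟩)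

variable [DecidableEq σ]

theorem monomial_mem_multigrading (m : σ →₀ ℕ) (c : K) :
    ∃ a, monomial m c ∈ multigrading K σ a :=
  ⟨_, (mem_weightedHomogeneousSubmodule _ _ _ _).2 (isWeightedHomogeneous_monomial _ m c rfl)⟩

/-- The exponents with support in an interval. -/
theorem support_mem_Icc_iff {A B : Finset σ} (hAB : A ⊆ B) (u : σ →₀ ℕ) :
    u.support ∈ Set.Icc A B ↔
      ∃ m : σ →₀ ℕ, m.support ⊆ B ∧ (Finsupp.indicator A fun _ _ => 1) + m = u := by
  constructor
  · rintro ⟨h1, h2⟩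
    refine ⟨u - Finsupp.indicator A fun _ _ => 1, Finsupp.support_tsub.trans h2, ?_⟩
    refine add_tsub_cancel_of_le fun i => ?_
    rw [Finsupp.indicator_apply]
    split_ifs with hi
    · exact Nat.one_le_iff_ne_zero.2 (Finsupp.mem_support_iff.1 (h1 hi))
    · exact Nat.zero_le _
  · rintro ⟨m, hm, rfl⟩
    refine ⟨fun i hi => ?_, fun i hi => ?_⟩
    · simp [Finsupp.indicator_apply, hi]
    · by_contra h
      have hA : i ∉ A := fun h' => h (hAB h')
      have hm' : m i = 0 := Finsupp.notMem_support_iff.1 fun h' => h (hm h')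
      simp [Finsupp.indicator_apply, hA, hm'] at hi

theorem support_indicator_one (A : Finset σ) :
    (Finsupp.indicator A fun _ _ => 1 : σ →₀ ℕ).support = A := by
  ext i
  simp [Finsupp.indicator_apply]

/-- Interval partitions of the sets of vertices give Stanley decompositions. -/
theorem le_sdepth_of_intervalPartition
    {M : Type*} [AddCommGroup M] [Module K M] [Module (MvPolynomial σ K) M]
    [IsScalarTower K (MvPolynomial σ K) M] {T : Set (σ →₀ ℕ)} (b : Module.Basis T K M)
    {𝒜 : (σ → ℤ) → Submodule K M} (hmem : ∀ t : T, ∃ a, b t ∈ 𝒜 a)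
    (hsmul : ∀ (t : T) (m : σ →₀ ℕ) (h : t.1 + m ∈ T),
      monomial m (1 : K) • b t = b ⟨t.1 + m, h⟩)
    {F : Set (Finset σ)} (hF : ∀ t, t ∈ T ↔ t.support ∈ F) {d : ℕ}
    (h : IntervalPartition d F) : (d : ℕ∞) ≤ sdepth 𝒜 := by
  obtain ⟨ι, _, A, B, hAB, hsub, hpart⟩ := h.exists_indexed
  have hT : ∀ i, (Finsupp.indicator (A i) fun _ _ => 1 : σ →₀ ℕ) ∈ T := fun i => by
    rw [hF, support_indicator_one]
    exact hsub i ⟨le_rfl, (hAB i).1⟩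
  refine le_sdepth_of_basis b hmem hsmul (fun i => ⟨_, hT i⟩) B ?_ ?_ (fun i => (hAB i).2)
  · intro i m hm
    rw [hF]
    exact hsub i ((support_mem_Icc_iff (hAB i).1 _).2 ⟨m, hm, rfl⟩)
  · intro u hu
    simpa only [support_mem_Icc_iff (hAB _).1] using hpart _ ((hF u).1 hu)

theorem le_sdepth_idealGrading [Fintype σ] {G : SimpleGraph σ} {d : ℕ}
    (h : IntervalPartition d (dependentSets G Finset.univ)) :
    (d : ℕ∞) ≤ sdepth (idealGrading (edgeIdeal K G)) := by
  obtain ⟨b, hb⟩ := exists_basis_edgeIdeal (K := K) G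
  refine le_sdepth_of_intervalPartition b ?_ ?_ ?_ h
  · intro t
    obtain ⟨a, ha⟩ := monomial_mem_multigrading t.1 (1 : K)
    exact ⟨a, by simpa [idealGrading, hb] using ha⟩
  · intro t m ht
    apply Subtype.ext
    rw [Submodule.coe_smul, hb, hb, smul_eq_mul, monomial_mul, one_mul, add_comm]
  · intro t
    simp [edgeExponents, dependentSets]

theorem le_sdepth_quotientGrading {G : SimpleGraph σ} {d : ℕ}
    (h : IntervalPartition d {B | ∀ i ∈ B, ∀ j ∈ B, ¬ G.Adj i j}) :
    (d : ℕ∞) ≤ sdepth (quotientGrading (edgeIdeal K G)) := by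
  obtain ⟨b, hb⟩ := exists_basis_quotient_edgeIdeal (K := K) G
  refine le_sdepth_of_intervalPartition b ?_ ?_ ?_ h
  · intro t
    obtain ⟨a, ha⟩ := monomial_mem_multigrading t.1 (1 : K)
    exact ⟨a, _, ha, (hb t).symm⟩
  · intro t m ht
    rw [hb, hb, ← map_smul, smul_eq_mul, monomial_mul, one_mul, add_comm]
  · intro t
    simp [edgeExponents]

/-- The Stanley depth of `S ⧸ I` is at most the cardinality of any maximal independent set. -/
theorem sdepth_quotientGrading_le {G : SimpleGraph σ} {A : Finset σ}
    (hA : ∀ i ∈ A, ∀ j ∈ A, ¬ G.Adj i j) (hmax : ∀ w, w ∉ A → ∃ i ∈ A, G.Adj i w) :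
    sdepth (quotientGrading (edgeIdeal K G)) ≤ A.card := by
  refine iSup_le fun D => ?_
  set a : σ →₀ ℕ := Finsupp.indicator A fun _ _ => 1 with ha
  have hasupp : a.support = A := support_indicator_one A
  have haI : a ∉ edgeExponents G := by
    rintro ⟨i, hi, j, hj, hij⟩
    rw [hasupp] at hi hj
    exact hA i hi j hj hij
  let π := (edgeIdeal K G).mkQ
  -- The degree determines the exponent, so a homogeneous element of S/I is the class of a single
  -- term.
  have hU : ∀ i, ∃ m : σ →₀ ℕ, ∃ c : K, D.v i = π (monomial m c) := by
    intro i
    obtain ⟨z, p, hp, hpv⟩ := D.homogeneous i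
    rw [← hpv]
    by_cases hp0 : p = 0
    · exact ⟨0, 0, by simp [hp0, π]⟩
    · obtain ⟨m, hm⟩ := support_nonempty.2 hp0
      have hp' : IsWeightedHomogeneous (fun i : σ => (Pi.single i 1 : σ → ℤ)) p z := hp
      have hw : ∀ m' : σ →₀ ℕ, Finsupp.weight (fun i : σ => (Pi.single i 1 : σ → ℤ)) m' =
          fun i => (m' i : ℤ) := by
        intro m'
        ext i
        rw [Finsupp.weight_apply, Finsupp.sum, Finset.sum_apply]
        simp [Pi.single_apply, eq_comm]
      refine ⟨m, p.coeff m, ?_⟩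
      suffices p = monomial m (p.coeff m) by rw [← this]; rfl
      ext m'
      rw [coeff_monomial]
      split_ifs with h
      · rw [h]
      · by_contra h0
        apply h
        have h1 := hp' (mem_support_iff.1 hm)
        have h2 := hp' h0
        rw [← h2, hw, hw] at h1
        ext i
        exact_mod_cast congrFun h1 i
  choose m c hmc using hU
  have hspan : π (monomial a 1) ∈ ⨆ i, stanleySpace K (D.v i) (D.W i) := by
    rw [D.isInternal.submodule_iSup_eq_top]
    trivial
  obtain ⟨g, hg⟩ := (Submodule.mem_iSup_iff_exists_finsupp _ _).1 hspan
  obtain ⟨hg, hsum⟩ := hg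
  choose f hf hfg using fun i => mem_stanleySpace.1 (hg i)
  rw [Finsupp.sum_fintype _ _ (fun _ => rfl)] at hsum
  have hmem : monomial a 1 - ∑ i, f i * monomial (m i) (c i) ∈ edgeIdeal K G := by
    rw [← Submodule.Quotient.mk_eq_zero]
    change π _ = 0
    rw [map_sub, map_sum, sub_eq_zero, ← hsum]
    refine Finset.sum_congr rfl fun i _ => ?_
    rw [← hfg, hmc, ← map_smul, smul_eq_mul]
  -- Elements of the ideal have no x^a term because A is independent, so comparing coefficients of
  -- x^a is legitimate modulo I.
  have hcoeff : ∑ i, coeff a (f i * monomial (m i) (c i)) = 1 := by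
    by_contra h
    refine haI (mem_edgeIdeal_iff.1 hmem a ?_)
    rw [mem_support_iff, coeff_sub, coeff_sum, coeff_monomial, if_pos rfl]
    exact sub_ne_zero.2 (Ne.symm h)
  obtain ⟨i, -, hi⟩ := Finset.exists_ne_zero_of_sum_ne_zero (hcoeff.trans_ne one_ne_zero)
  rw [coeff_mul_monomial'] at hi
  have hle : m i ≤ a := by
    by_contra h
    exact hi (if_neg h)
  rw [if_pos hle] at hi
  have hfi : a - m i ∈ (f i).support := mem_support_iff.2 (left_ne_zero_of_mul hi)
  have hsub := mem_supported_iff_forall_support.1 (hf i) _ hfi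
  -- If w were in W i but not in A, then x^(a - m i) x_w in K[W i] would send the generator to a
  -- multiple of x^a x_w. This is 0 in S/I, as w has a neighbour in A, against freeness.
  have hWA : D.W i ⊆ A := by
    intro w hw
    by_contra hwA
    obtain ⟨j, hj, hjw⟩ := hmax w hwA
    have hsupp : (a - m i + Finsupp.single w 1).support ⊆ D.W i := by
      refine Finsupp.support_add.trans (Finset.union_subset hsub ?_)
      exact Finsupp.support_single_subset.trans (Finset.singleton_subset_iff.2 hw)
    have h0 := D.free i _ (monomial_mem_supported hsupp (1 : K)) (by
      rw [hmc, ← map_smul, smul_eq_mul, monomial_mul, one_mul]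
      refine (Submodule.Quotient.mk_eq_zero _).2
        ((monomial_mem_edgeIdeal_iff (right_ne_zero_of_mul hi)).2 ⟨j, ?_, w, ?_, hjw⟩)
      · rw [add_right_comm, tsub_add_cancel_of_le hle]
        have : a j ≠ 0 := by rw [← Finsupp.mem_support_iff, hasupp]; exact hj
        rw [Finsupp.mem_support_iff, Finsupp.add_apply]
        omega
      · simp)
    exact one_ne_zero (monomial_eq_zero.1 h0)
  refine (iInf_le _ i).trans ?_
  exact_mod_cast Finset.card_le_card hWA

end Ideals

end StanleyDepth
end

/-! ### Powers of paths and cycles -/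

noncomputable section
namespace StanleyDepth

open Finset

section CyclePower

variable {n k : ℕ}

instance : DecidableRel (cyclePower n k).Adj := fun i j => by
  unfold cyclePower
  infer_instance

theorem cyclePower_adj {i j : Fin n} : (cyclePower n k).Adj i j ↔ i.1 ≠ j.1 ∧
    ((i.1 ≤ j.1 + k ∧ j.1 ≤ i.1 + k) ∨ n + i.1 ≤ j.1 + k ∨ n + j.1 ≤ i.1 + k) := by
  change (i ≠ j ∧ (|((j : ℕ) : ℤ) - ((i : ℕ) : ℤ)| ≤ (k : ℤ) ∨
    (n : ℤ) - (k : ℤ) ≤ |((j : ℕ) : ℤ) - ((i : ℕ) : ℤ)|)) ↔ _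
  rw [ne_eq, Fin.ext_iff, abs_le, le_abs]
  omega

/-- The vertices in the segment `[a, b)`. -/
def segment (n a b : ℕ) : Finset (Fin n) := {i | a ≤ i.1 ∧ i.1 < b}

theorem mem_segment {a b : ℕ} {i : Fin n} : i ∈ segment n a b ↔ a ≤ i.1 ∧ i.1 < b := by
  simp [segment]

theorem card_segment {a b : ℕ} (hb : b ≤ n) : (segment n a b).card = b - a := by
  rw [← Nat.card_Ico, ← card_map Fin.valEmbedding]
  congr 1
  ext i
  simp only [mem_map, mem_segment, Fin.valEmbedding_apply, mem_Ico]
  constructor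
  · rintro ⟨j, hj, rfl⟩
    exact hj
  · exact fun h => ⟨⟨i, by omega⟩, h, rfl⟩

theorem le_mul_two_mul_add_one (c : ℕ) (hk : 1 ≤ k) : 3 * c ≤ c * (2 * k + 1) := by
  rw [mul_comm]
  exact Nat.mul_le_mul_left c (by omega)

/-- A segment with more than `c(2k+1)` vertices, short enough not to close up, is a power of a
path. -/
theorem intervalPartition_segment (hk : 1 ≤ k) (c : ℕ) : ∀ a b : ℕ, b ≤ n → b + k ≤ a + n →
    (c = 0 ∨ a + c * (2 * k + 1) < b) →
    IntervalPartition (c + 2) (dependentSets (cyclePower n k) (segment n a b)) := by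
  induction c with
  | zero => exact fun a b _ _ _ => intervalPartition_dependentSets_two _
  | succ c ih =>
    intro a b hb hab hc
    have hc3 := le_mul_two_mul_add_one c hk
    have hlen : a + c * (2 * k + 1) + (2 * k + 1) < b := by
      rw [add_mul, one_mul] at hc
      omega
    -- These v are the neighbours of the end a inside the segment. What is not adjacent to v starts
    -- at v + k + 1 ≤ a + 2k + 1, so at most 2k+1 vertices are lost.
    have hfar : ∀ v ∈ segment n (a + 1) (a + k + 1),
        {i ∈ segment n a b | i ≠ v ∧ ¬ (cyclePower n k).Adj v i} =
          segment n (v.1 + k + 1) b := by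
      intro v hv
      ext i
      simp only [mem_segment, mem_filter, cyclePower_adj, ne_eq, Fin.ext_iff] at *
      omega
    refine .dependentSets_of_sdiff (segment n (a + 1) (a + k + 1)) ?_ ?_ ?_ ?_ ?_
    · intro i hi
      simp only [mem_segment] at *
      omega
    · intro i hi j hj hij
      simp only [mem_segment, cyclePower_adj, ne_eq, Fin.ext_iff] at *
      omega
    · have : segment n a b \ segment n (a + 1) (a + k + 1) =
          insert ⟨a, by omega⟩ (segment n (a + k + 1) b) := by
        ext i
        simp only [mem_segment, mem_sdiff, mem_insert, Fin.ext_iff]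
        omega
      rw [this]
      refine .dependentSets_insert_isolated ?_ ?_ (ih _ _ hb (by omega) (by omega))
      · simp only [mem_segment]
        omega
      · intro i hi
        simp only [mem_segment, cyclePower_adj] at *
        omega
    · intro v hv
      rw [hfar v hv]
      rw [mem_segment] at hv
      exact ih _ _ hb (by omega) (by omega)
    · intro v hv
      rw [hfar v hv, card_segment hb]
      rw [mem_segment] at hv
      omega

/-- Eliminating the clique 0, …, k-1 opens the cycle: the other n - k vertices form a path power,
whence the extra k in the hypothesis. The non-neighbours of each eliminated vertex form a segment of
n - 2k - 1 vertices, long enough for depth one less. -/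
theorem intervalPartition_cyclePower (hk : 1 ≤ k) (hn : 2 * k + 2 ≤ n) {c : ℕ}
    (hc : c = 0 ∨ c * (2 * k + 1) + k < n) :
    IntervalPartition (c + 2) (dependentSets (cyclePower n k) univ) := by
  obtain - | c := c
  · exact intervalPartition_dependentSets_two _
  have hc3 := le_mul_two_mul_add_one c hk
  have hlen : c * (2 * k + 1) + (2 * k + 1) + k < n := by
    rw [add_mul, one_mul] at hc
    omega
  have hfar : ∀ v ∈ segment n 0 k,
      ({i ∈ univ | i ≠ v ∧ ¬ (cyclePower n k).Adj v i} : Finset (Fin n)) =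
        segment n (v.1 + k + 1) (v.1 + n - k) := by
    intro v hv
    ext i
    have := i.2
    simp only [mem_segment, mem_filter, cyclePower_adj, ne_eq, Fin.ext_iff, mem_univ,
      true_and] at *
    omega
  refine .dependentSets_of_sdiff (segment n 0 k) (subset_univ _) ?_ ?_ ?_ ?_
  · intro i hi j hj hij
    simp only [mem_segment, cyclePower_adj, ne_eq, Fin.ext_iff] at *
    omega
  · have : univ \ segment n 0 k = segment n k n := by
      ext i
      simp only [mem_segment, mem_sdiff, mem_univ, true_and]
      omega
    rw [this]
    exact intervalPartition_segment hk (c + 1) _ _ le_rfl (by omega)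
      (.inr (by rw [add_mul, one_mul]; omega))
  · intro v hv
    rw [hfar v hv]
    rw [mem_segment] at hv
    exact intervalPartition_segment hk c _ _ (by omega) (by omega) (.inr (by omega))
  · intro v hv
    rw [hfar v hv]
    rw [mem_segment] at hv
    rw [card_segment (by omega)]
    omega

/-- The points `0, 2k+1, 2(2k+1), …`, with the last one moved away from `0` if necessary, form a
maximal independent set. -/
theorem exists_maximal_independent_cyclePower {q r : ℕ} (hq : 1 ≤ q)
    (hn : n = q * (2 * k + 1) + r) (hr : 1 ≤ r) (hr' : r ≤ 2 * k + 1) :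
    ∃ A : Finset (Fin n), A.card ≤ q + 1 ∧
      (∀ i ∈ A, ∀ j ∈ A, ¬ (cyclePower n k).Adj i j) ∧
      ∀ w, w ∉ A → ∃ i ∈ A, (cyclePower n k).Adj i w := by
  have hqk : 2 * k + 1 ≤ q * (2 * k + 1) := Nat.le_mul_of_pos_left _ hq
  -- Only j = q can be affected by the minimum. The vertex n - k - 1 is at cyclic distance k+1 from
  -- 0; when the last point is moved there, it is still k + r ≥ k + 1 away from the preceding point.
  let a : ℕ → Fin n := fun j => ⟨min (j * (2 * k + 1)) (n - k - 1), by omega⟩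
  have hsep : ∀ i j, i < j → j ≤ q → ¬ (cyclePower n k).Adj (a i) (a j) := by
    intro i j hij hj
    have h1 : i * (2 * k + 1) + (2 * k + 1) ≤ j * (2 * k + 1) := by
      rw [← Nat.succ_mul]
      exact Nat.mul_le_mul_right _ hij
    have h2 : j * (2 * k + 1) ≤ q * (2 * k + 1) := Nat.mul_le_mul_right _ hj
    rw [cyclePower_adj]
    simp only [a]
    omega
  refine ⟨(range (q + 1)).image a, card_image_le.trans (card_range _).le, ?_, ?_⟩
  · intro x hx y hy
    obtain ⟨i, hi, rfl⟩ := mem_image.1 hx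
    obtain ⟨j, hj, rfl⟩ := mem_image.1 hy
    rw [mem_range] at hi hj
    rcases lt_trichotomy i j with h | rfl | h
    · exact hsep i j h (by omega)
    · exact (cyclePower n k).loopless.irrefl _
    · exact fun h' => hsep j i h (by omega) h'.symm
  · intro w hw
    have hne : ∀ j ≤ q, (a j).1 ≠ w.1 := fun j hj h =>
      hw (mem_image.2 ⟨j, mem_range.2 (by omega), Fin.ext h⟩)
    suffices ∃ j ≤ q, (cyclePower n k).Adj (a j) w by
      obtain ⟨j, hj, h⟩ := this
      exact ⟨a j, mem_image_of_mem a (mem_range.2 (by omega)), h⟩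
    have hwn := w.2
    obtain ⟨j, s, hs, hjs⟩ : ∃ j s, s < 2 * k + 1 ∧ w.1 = j * (2 * k + 1) + s :=
      ⟨w.1 / (2 * k + 1), w.1 % (2 * k + 1), Nat.mod_lt _ (by omega),
        (Nat.div_add_mod' _ _).symm⟩
    -- The last k vertices are adjacent to 0 across the seam. Any other w is at most n - k - 1, so
    -- it is dominated by the last point or by the nearer of the two points around it.
    by_cases hw0 : n ≤ w.1 + k
    · refine ⟨0, by omega, cyclePower_adj.2 ⟨hne 0 (by omega), ?_⟩⟩
      simp only [a]
      omega
    · have hjq : j ≤ q := by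
        by_contra h
        have h1 : (q + 1) * (2 * k + 1) ≤ j * (2 * k + 1) := Nat.mul_le_mul_right _ (by omega)
        rw [add_mul, one_mul] at h1
        omega
      rcases hjq.eq_or_lt with rfl | hjq
      · refine ⟨j, le_rfl, cyclePower_adj.2 ⟨hne j le_rfl, ?_⟩⟩
        simp only [a]
        omega
      · have h1 : j * (2 * k + 1) + (2 * k + 1) ≤ q * (2 * k + 1) := by
          rw [← Nat.succ_mul]
          exact Nat.mul_le_mul_right _ hjq
        by_cases hsk : s ≤ k
        · refine ⟨j, hjq.le, cyclePower_adj.2 ⟨hne j hjq.le, ?_⟩⟩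
          simp only [a]
          omega
        · refine ⟨j + 1, hjq, cyclePower_adj.2 ⟨hne (j + 1) hjq, ?_⟩⟩
          simp only [a, add_mul, one_mul]
          omega

variable (K : Type*) [Field K]

theorem sdepth_quotient_cycleIdeal_le {q r : ℕ} (hq : 1 ≤ q)
    (hn : n = q * (2 * k + 1) + r) (hr : 1 ≤ r) (hr' : r ≤ 2 * k + 1) :
    sdepth (quotientGrading (cycleIdeal K n k)) ≤ (q + 1 : ℕ) := by
  obtain ⟨A, hA, hind, hmax⟩ := exists_maximal_independent_cyclePower hq hn hr hr'
  exact (sdepth_quotientGrading_le hind hmax).trans (by exact_mod_cast hA)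

theorem sdepth_quotient_cycleIdeal_eq_one (hn : 1 ≤ n) (hnk : n ≤ 2 * k + 1) :
    sdepth (quotientGrading (cycleIdeal K n k)) = 1 := by
  have hadj : ∀ i j : Fin n, (cyclePower n k).Adj i j ↔ i ≠ j := by
    intro i j
    have := i.2
    have := j.2
    rw [cyclePower_adj, ne_eq, ne_eq, Fin.ext_iff]
    omega
  apply le_antisymm
  · have h := sdepth_quotientGrading_le (K := K) (G := cyclePower n k) (A := {⟨0, hn⟩})
      (by simp) (by simp [hadj, eq_comm])
    simpa using h
  · have h : IntervalPartition 1
        {B : Finset (Fin n) | ∀ i ∈ B, ∀ j ∈ B, ¬ (cyclePower n k).Adj i j} := by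
      -- The graph is complete, so only the empty set and singletons are independent; the empty set
      -- is paired with one singleton.
      have : {B : Finset (Fin n) | ∀ i ∈ B, ∀ j ∈ B, ¬ (cyclePower n k).Adj i j} =
          Set.Icc ∅ {⟨0, hn⟩} ∪ (fun i => {i}) '' {i : Fin n | i ≠ ⟨0, hn⟩} := by
        ext B
        simp only [Set.mem_ofPred_eq, hadj, not_not, Set.mem_union, Set.mem_Icc, empty_subset,
          true_and, Set.mem_image]
        constructor
        · intro h
          by_cases h0 : B ⊆ {⟨0, hn⟩}
          · exact .inl h0
          · obtain ⟨i, hi, hi0⟩ := not_subset.1 h0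
            exact .inr ⟨i, by simpa using hi0, (eq_singleton_iff_unique_mem.2
              ⟨hi, fun j hj => h j hj i hi⟩).symm⟩
        · rintro (h | ⟨i, _, rfl⟩)
          · intro i hi j hj
            rw [mem_singleton.1 (h hi), mem_singleton.1 (h hj)]
          · simp
      rw [this]
      refine .union _ _ ?_ (.icc _ _ (empty_subset _) (by simp))
        (.of_forall_card (Set.toFinite _) ?_)
      · rw [Set.disjoint_left]
        rintro _ ⟨_, hB⟩ ⟨i, hi, rfl⟩
        exact hi (by simpa using hB)
      · rintro _ ⟨i, _, rfl⟩
        simp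
    exact_mod_cast le_sdepth_quotientGrading (K := K) h

end CyclePower

end StanleyDepth
end

/-! ### Comparison of the two bounds -/

open StanleyDepth in
theorem corollary5p5 (K : Type*) [Field K] (n k : ℕ) (hk : 1 ≤ k) (hn : 3 ≤ n) :
    sdepth (quotientGrading (cycleIdeal K n k)) ≤ sdepth (idealGrading (cycleIdeal K n k)) ∧
    (n ≤ 2 * k + 1 →
      2 ≤ sdepth (idealGrading (cycleIdeal K n k)) ∧
      sdepth (quotientGrading (cycleIdeal K n k)) + 1 = 2) ∧
    (2 * k + 2 ≤ n →
      ((∃ r ∈ Finset.Icc 1 k, n ≡ r [MOD 2 * k + 1]) →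
        sdepth (quotientGrading (cycleIdeal K n k)) ≤ sdepth (idealGrading (cycleIdeal K n k))) ∧
      ((n ≡ 0 [MOD 2 * k + 1] ∨ ∃ r ∈ Finset.Icc (k + 1) (2 * k), n ≡ r [MOD 2 * k + 1]) →
        sdepth (quotientGrading (cycleIdeal K n k)) + 1 ≤
          sdepth (idealGrading (cycleIdeal K n k)))) := by
  have hsmall : n ≤ 2 * k + 1 → 2 ≤ sdepth (idealGrading (cycleIdeal K n k)) ∧
      sdepth (quotientGrading (cycleIdeal K n k)) = 1 := fun h =>
    ⟨le_sdepth_idealGrading (d := 2) (intervalPartition_dependentSets_two _),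
      sdepth_quotient_cycleIdeal_eq_one K (by omega) h⟩
  have hlarge : 2 * k + 2 ≤ n →
      sdepth (quotientGrading (cycleIdeal K n k)) ≤ sdepth (idealGrading (cycleIdeal K n k)) ∧
      (n % (2 * k + 1) = 0 ∨ k + 1 ≤ n % (2 * k + 1) →
        sdepth (quotientGrading (cycleIdeal K n k)) + 1 ≤
          sdepth (idealGrading (cycleIdeal K n k))) := by
    intro h
    -- Dividing n - 1 instead of n turns residue 0 into r = 2k+1, so both favourable cases become r
    -- ≥ k + 1.
    obtain ⟨q, r, hq, hqr, hr, hr'⟩ : ∃ q r, 1 ≤ q ∧ n = q * (2 * k + 1) + r ∧ 1 ≤ r ∧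
        r ≤ 2 * k + 1 := by
      refine ⟨(n - 1) / (2 * k + 1), (n - 1) % (2 * k + 1) + 1, ?_, ?_, by omega, ?_⟩
      · exact (Nat.one_le_div_iff (by omega)).2 (by omega)
      · have := Nat.div_add_mod' (n - 1) (2 * k + 1)
        omega
      · exact Nat.mod_lt _ (by omega)
    have hup := sdepth_quotient_cycleIdeal_le K hq hqr hr hr'
    obtain ⟨c, rfl⟩ : ∃ c, q = c + 1 := ⟨q - 1, by omega⟩
    refine ⟨hup.trans (le_sdepth_idealGrading (intervalPartition_cyclePower hk h (.inr ?_))),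
      fun hmod => ?_⟩
    · rw [hqr, add_mul, one_mul]
      omega
    · have hrk : k + 1 ≤ r := by
        rcases hr'.eq_or_lt with rfl | hr'
        · omega
        · rw [hqr, Nat.mul_comm, Nat.mul_add_mod, Nat.mod_eq_of_lt hr'] at hmod
          omega
      refine (add_le_add_left hup 1).trans ?_
      exact_mod_cast le_sdepth_idealGrading (K := K)
        (intervalPartition_cyclePower hk h (c := c + 1) (.inr (by omega)))
  refine ⟨?_, fun h => ?_, fun h => ⟨fun _ => (hlarge h).1, fun hmod => (hlarge h).2 ?_⟩⟩
  · rcases le_or_gt n (2 * k + 1) with h | h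
    · rw [(hsmall h).2]
      exact le_trans one_le_two (hsmall h).1
    · exact (hlarge h).1
  · rw [(hsmall h).2]
    exact ⟨(hsmall h).1, one_add_one_eq_two⟩
  · rcases hmod with h0 | ⟨r, hr, hnr⟩
    · left
      rw [h0, Nat.zero_mod]
    · right
      rw [Finset.mem_Icc] at hr
      rw [hnr, Nat.mod_eq_of_lt (by omega)]
      exact hr.1
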